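/- Let $(X,d)$ be a compact metric space, let $f\colon X\to X$ be a homeomorphism and let $n\in\mathbb N$. Assume that: 1. $f$ is $n$-expansive: there is $c>0$ such that for every $x\in X$ the set $\{y\in X : d(f^k(y),f^k(x))\le c \text{ for all } k\in\mathbb Z\}$ has at most $n$ points; 2. $f$ is transitive: for all non-empty open sets $U,V\subset X$ there is $k\in\mathbb N$ with $f^k(U)\cap V\neq\emptyset$; 3. $f$ has the shadowing property: for every $\varepsilon>0$ there is $\delta>0$ such that for every sequence $(x_k)_{k\in\mathbb Z}$ in $X$ with $d(f(x_k),x_{k+1})<\delta$ for all $k\in\mathbb Z$ there is $y\in X$ with $d(f^k(y),x_k)<\varepsilon$ for all $k\in\mathbb Z$. Then $f$ has the two-sided limit shadowing property with a gap: there is $N\in\mathbb N$ such that for every sequence $(x_k)_{k\in\mathbb Z}$ in $X$ with $d(f(x_k),x_{k+1})\to 0$ as $|k|\to\infty$ there are $K\in\mathbb Z$ with $|K|\le N$ and $y\in X$ satisfying $$d(f^k(y),x_k)\to 0 \ \text{ as } k\to-\infty,\qquad d(f^{K+k}(y),x_k)\to 0\ \text{ as } k\to\infty.$$ -/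

import Mathlib

/-!
Dynamics of a homeomorphism `f : X ≃ₜ X` of a metric space.  For `k : ℤ`, the integer iterate
is `f ^ k`, the power in the group of self-homeomorphisms of `X` (multiplication is composition).
-/

namespace ShadowingGap

open Filter Topology

variable {X : Type*} [MetricSpace X]

/-- Local stable set of `x` of size `c`. -/
def localStableSet (f : X ≃ₜ X) (c : ℝ) (x : X) : Set X :=
  {y | ∀ k : ℤ, 0 ≤ k → dist ((f ^ k) y) ((f ^ k) x) ≤ c}

/-- Local unstable set of `x` of size `c`. -/
def localUnstableSet (f : X ≃ₜ X) (c : ℝ) (x : X) : Set X :=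
  {y | ∀ k : ℤ, k ≤ 0 → dist ((f ^ k) y) ((f ^ k) x) ≤ c}

/-- `f` is `n`-expansive: for some `c > 0` every dynamical ball of size `c` has at most
`n` points. -/
def IsNExpansive (f : X ≃ₜ X) (n : ℕ) : Prop :=
  ∃ c : ℝ, 0 < c ∧ ∀ x : X, (localStableSet f c x ∩ localUnstableSet f c x).encard ≤ n

/-- `f` is (topologically) transitive. -/
def IsTransitive (f : X ≃ₜ X) : Prop :=
  ∀ U V : Set X, IsOpen U → IsOpen V → U.Nonempty → V.Nonempty →
    ∃ k : ℕ, ((f ^ (k : ℤ)) '' U ∩ V).Nonempty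

/-- Bilateral `δ`-pseudo-orbits. -/
def IsPseudoOrbit (f : X ≃ₜ X) (δ : ℝ) (x : ℤ → X) : Prop :=
  ∀ k : ℤ, dist (f (x k)) (x (k + 1)) < δ

/-- The sequence `x` is `ε`-shadowed by some point. -/
def IsShadowed (f : X ≃ₜ X) (ε : ℝ) (x : ℤ → X) : Prop :=
  ∃ y : X, ∀ k : ℤ, dist ((f ^ k) y) (x k) < ε

/-- The (standard) shadowing property. -/
def HasShadowing (f : X ≃ₜ X) : Prop :=
  ∀ ε : ℝ, 0 < ε → ∃ δ : ℝ, 0 < δ ∧ ∀ x : ℤ → X, IsPseudoOrbit f δ x → IsShadowed f ε x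

/-- Two-sided limit pseudo-orbits: `d (f (x k), x (k + 1)) → 0` as `|k| → ∞`, that is, both as
`k → -∞` and as `k → ∞`. -/
def IsTwoSidedLimitPseudoOrbit (f : X ≃ₜ X) (x : ℤ → X) : Prop :=
  Tendsto (fun k : ℤ => dist (f (x k)) (x (k + 1))) (atBot ⊔ atTop) (𝓝 0)

/-- The sequence `x` is two-sided limit shadowed with gap `K`. -/
def IsTwoSidedLimitShadowedWithGap (f : X ≃ₜ X) (K : ℤ) (x : ℤ → X) : Prop :=
  ∃ y : X,
    Tendsto (fun k : ℤ => dist ((f ^ k) y) (x k)) atBot (𝓝 0) ∧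
    Tendsto (fun k : ℤ => dist ((f ^ (K + k)) y) (x k)) atTop (𝓝 0)

/-- The two-sided limit shadowing property with gap `N`. -/
def HasTwoSidedLimitShadowingWithGap (f : X ≃ₜ X) (N : ℕ) : Prop :=
  ∀ x : ℤ → X, IsTwoSidedLimitPseudoOrbit f x →
    ∃ K : ℤ, |K| ≤ (N : ℤ) ∧ IsTwoSidedLimitShadowedWithGap f K x

/-- The two-sided limit shadowing property with a gap: the bound `N` is uniform over all
two-sided limit pseudo-orbits. -/
def HasTwoSidedLimitShadowingWithAGap (f : X ≃ₜ X) : Prop :=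
  ∃ N : ℕ, HasTwoSidedLimitShadowingWithGap f N

end ShadowingGap

namespace ShadowingGap

open Filter Topology

section Iterates

variable {X : Type*} [MetricSpace X]

/-! Of `n`-expansivity only the finiteness of dynamical balls is used: each point is isolated in its
own ball. With shadowing this forces a rigidity: a point following a tail of a limit pseudo-orbit
closely enough is asymptotic to it (`exists_tail_shadowing_tendsto`). The required closeness may
depend on the pseudo-orbit, so it suffices to shadow both tails by one orbit at that scale.

To this end the tails are cut near cluster points `q` and `p` and joined by a chain through a fixed
periodic point `z` of period `M`. Looping at `z` adjusts the length of the chain by multiples of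
`M`, so the delay can be taken in `[0, M)`, a bound depending on `f` alone. -/

theorem zpow_add_apply (f : X ≃ₜ X) (a b : ℤ) (y : X) : (f ^ (a + b)) y = (f ^ a) ((f ^ b) y) := by
  rw [zpow_add]; rfl

theorem zpow_add_one_apply (f : X ≃ₜ X) (a : ℤ) (y : X) : (f ^ (a + 1)) y = f ((f ^ a) y) := by
  rw [add_comm, zpow_add_apply, zpow_one]

theorem inv_zpow_apply (f : X ≃ₜ X) (a : ℤ) (y : X) : (f⁻¹ ^ a) y = (f ^ (-a)) y := by
  rw [inv_zpow, zpow_neg]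

/-- The two-sided dynamical ball of radius `c` around `x`. -/
def dynamicalBall (f : X ≃ₜ X) (c : ℝ) (x : X) : Set X :=
  {y | ∀ k : ℤ, dist ((f ^ k) y) ((f ^ k) x) ≤ c}

theorem IsNExpansive.exists_finite_dynamicalBall {f : X ≃ₜ X} {n : ℕ} (h : IsNExpansive f n) :
    ∃ c : ℝ, 0 < c ∧ ∀ x, (dynamicalBall f c x).Finite := by
  obtain ⟨c, hc, h⟩ := h
  refine ⟨c, hc, fun x => ?_⟩
  refine Set.Finite.subset (Set.finite_of_encard_le_coe (h x)) fun y hy => ?_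
  exact ⟨fun k _ => hy k, fun k _ => hy k⟩

theorem dynamicalBall_inv (f : X ≃ₜ X) (c : ℝ) (x : X) :
    dynamicalBall f⁻¹ c x = dynamicalBall f c x := by
  ext y
  simp only [dynamicalBall, Set.mem_ofPred_eq, inv_zpow_apply]
  exact ⟨fun h k => by simpa using h (-k), fun h k => h (-k)⟩

theorem exists_isolating_radius {S : Set X} (hS : S.Finite) (a : X) :
    ∃ r : ℝ, 0 < r ∧ ∀ y ∈ S, dist y a ≤ r → y = a := by
  have h : (S \ {a})ᶜ ∈ 𝓝 a :=
    (hS.subset Set.sdiff_subset).isClosed.isOpen_compl.mem_nhds (by simp)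
  obtain ⟨r, hr, hr'⟩ := Metric.nhds_basis_closedBall.mem_iff.1 h
  refine ⟨r, hr, fun y hy hya => ?_⟩
  by_contra hne
  exact hr' (Metric.mem_closedBall.2 hya) ⟨hy, hne⟩

end Iterates

/-! ### Time reversal -/

section Inverse

variable {X : Type*} [MetricSpace X] [CompactSpace X]

theorem exists_dist_inv_lt (f : X ≃ₜ X) {ε : ℝ} (hε : 0 < ε) :
    ∃ δ : ℝ, 0 < δ ∧ ∀ a b : X, dist (f a) b < δ → dist (f⁻¹ b) a < ε := by
  have hu : UniformContinuous (f⁻¹ : X ≃ₜ X) :=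
    CompactSpace.uniformContinuous_of_continuous (f⁻¹ : X ≃ₜ X).continuous
  obtain ⟨δ, hδ, h⟩ := Metric.uniformContinuous_iff.1 hu ε hε
  refine ⟨δ, hδ, fun a b hab => ?_⟩
  have := h hab
  rw [dist_comm]
  have e : f⁻¹ (f a) = a := f.symm_apply_apply a
  rwa [e] at this

theorem HasShadowing.inv {f : X ≃ₜ X} (hs : HasShadowing f) : HasShadowing f⁻¹ := by
  intro ε hε
  obtain ⟨δ, hδ, h⟩ := hs ε hε
  obtain ⟨δ', hδ', h'⟩ := exists_dist_inv_lt f⁻¹ hδ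
  refine ⟨δ', hδ', fun x hx => ?_⟩
  obtain ⟨y, hy⟩ := h (fun k => x (-k)) fun k => by
    have := h' _ _ (hx (-(k + 1)))
    rwa [inv_inv, show -(k + 1) + 1 = -k by ring] at this
  refine ⟨y, fun k => ?_⟩
  rw [inv_zpow_apply]
  simpa using hy (-k)

end Inverse

/-! ### From shadowing a tail to limit shadowing -/

section LimitShadowing

variable {X : Type*} [MetricSpace X]

/-- A point which stays `ε`-close to a forward limit pseudo-orbit and is proximal to it is
asymptotic to it, when dynamical balls are finite. -/
theorem tendsto_dist_of_frequently_small {f : X ≃ₜ X} (hs : HasShadowing f) {c : ℝ} (hc : 0 < c)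
    (hfin : ∀ x, (dynamicalBall f c x).Finite) {x : ℤ → X}
    (hx : Tendsto (fun k : ℤ => dist (f (x k)) (x (k + 1))) atTop (𝓝 0)) {y : X}
    (hclose : ∀ᶠ k : ℤ in atTop, dist ((f ^ k) y) (x k) < c / 2)
    (hprox : ∀ η > 0, ∃ᶠ k : ℤ in atTop, dist ((f ^ k) y) (x k) < η) :
    Tendsto (fun k : ℤ => dist ((f ^ k) y) (x k)) atTop (𝓝 0) := by
  obtain ⟨r, hr, hiso⟩ := exists_isolating_radius (hfin y) y
  rw [Metric.tendsto_atTop']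
  intro ε hε
  set ε' := min ε (min r (c / 2))
  have hpos : 0 < ε' := by positivity
  obtain ⟨δ, hδ, hsh⟩ := hs ε' hpos
  have herr : ∀ᶠ k : ℤ in atTop, dist (f (x k)) (x (k + 1)) < δ := hx.eventually_lt_const hδ
  obtain ⟨T, hT⟩ := eventually_atTop.1 (herr.and hclose)
  obtain ⟨m, hm, hmT⟩ := ((hprox δ hδ).and_eventually (eventually_gt_atTop (max T 0))).exists
  have hmT' : T < m := lt_of_le_of_lt (le_max_left _ _) hmT
  have hm0 : 0 < m := lt_of_le_of_lt (le_max_right _ _) hmT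
  -- Switch from the orbit of `y` to `x` at a time `m` when they are close. The shadowing point
  -- stays in the dynamical ball of `y` and, as `m > 0`, is within `r` of `y` at time `0`; so it is
  -- `y` itself.
  obtain ⟨z, hz⟩ := hsh (fun k => if k < m then (f ^ k) y else x k) fun k => by
    rcases lt_trichotomy (k + 1) m with h | h | h
    · simp only [if_pos h, if_pos (show k < m by omega), zpow_add_one_apply, dist_self, hδ]
    · simp only [h, lt_irrefl, if_false, if_pos (show k < m by omega)]
      rwa [← zpow_add_one_apply, h]
    · simp only [if_neg (show ¬ k + 1 < m by omega), if_neg (show ¬ k < m by omega)]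
      exact (hT k (by omega)).1
  dsimp only at hz
  have hzy : z = y := by
    refine hiso z (fun k => ?_) ?_
    · have h1 := hz k
      have h2 : ε' ≤ c / 2 := (min_le_right _ _).trans (min_le_right _ _)
      by_cases hk : k < m
      · rw [if_pos hk] at h1
        linarith
      · rw [if_neg hk] at h1
        have h3 := (hT k (by omega)).2
        have := dist_triangle_right ((f ^ k) z) ((f ^ k) y) (x k)
        linarith
    · have h1 := hz 0
      rw [if_pos hm0] at h1
      exact h1.le.trans ((min_le_right _ _).trans (min_le_left _ _))
  subst hzy
  refine ⟨m, fun k hk => ?_⟩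
  have h1 := hz k
  rw [if_neg (by omega)] at h1
  rw [Real.dist_0_eq_abs, abs_of_nonneg dist_nonneg]
  exact h1.trans_le (min_le_left _ _)

/-- The errors vanish at infinity, so limits of shifted limit pseudo-orbits are true orbits. -/
theorem tendsto_shift_zpow {f : X ≃ₜ X} {x : ℤ → X} {U : Filter ℤ} (hU : U ≤ atTop)
    (hx : Tendsto (fun k : ℤ => dist (f (x k)) (x (k + 1))) atTop (𝓝 0)) {p : X}
    (hp : Tendsto x U (𝓝 p)) (k : ℤ) : Tendsto (fun m => x (m + k)) U (𝓝 ((f ^ k) p)) := by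
  have herr : ∀ j : ℤ, Tendsto (fun m => dist (f (x (m + j))) (x (m + j + 1))) U (𝓝 0) := fun j =>
    (hx.comp (tendsto_atTop_add_const_right _ j tendsto_id)).mono_left hU
  induction k with
  | zero => simpa using hp
  | succ i ih =>
    have h1 : Tendsto (fun m => f (x (m + i))) U (𝓝 ((f ^ ((i : ℤ) + 1)) p)) := by
      rw [zpow_add_one_apply]
      exact (f.continuous.tendsto _).comp ih
    simpa only [add_assoc] using h1.congr_dist (herr i)
  | pred i ih =>
    have h1 : Tendsto (fun m => f (x (m + (-(i : ℤ) - 1)))) U (𝓝 ((f ^ (-(i : ℤ))) p)) := by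
      refine ih.congr_dist ?_
      refine (herr (-(i : ℤ) - 1)).congr fun m => ?_
      rw [dist_comm]
      congr 2
      ring
    have h2 := (f.symm.continuous.tendsto _).comp h1
    have e : f.symm ((f ^ (-(i : ℤ))) p) = (f ^ (-(i : ℤ) - 1)) p := by
      rw [f.symm_apply_eq, ← zpow_add_one_apply, sub_add_cancel]
    rw [e] at h2
    simpa [Function.comp_def] using h2

variable [CompactSpace X]

/-- For a forward limit pseudo-orbit, sufficiently precise shadowing of a tail is automatically
limit shadowing. -/
theorem exists_tail_shadowing_tendsto {f : X ≃ₜ X} (hs : HasShadowing f) {c : ℝ} (hc : 0 < c)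
    (hfin : ∀ x, (dynamicalBall f c x).Finite) {x : ℤ → X}
    (hx : Tendsto (fun k : ℤ => dist (f (x k)) (x (k + 1))) atTop (𝓝 0)) :
    ∃ ε : ℝ, 0 < ε ∧ ∀ y : X, (∀ᶠ k : ℤ in atTop, dist ((f ^ k) y) (x k) < ε) →
      Tendsto (fun k : ℤ => dist ((f ^ k) y) (x k)) atTop (𝓝 0) := by
  -- An ultrafilter makes `x` and every orbit converge along one common filter.
  let U : Ultrafilter ℤ := Ultrafilter.of atTop
  have hU : (U : Filter ℤ) ≤ atTop := Ultrafilter.of_le _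
  have hlim : ∀ u : ℤ → X, ∃ p, Tendsto u U (𝓝 p) := fun u => by
    obtain ⟨p, -, hp⟩ := isCompact_univ.ultrafilter_le_nhds (U.map u) (by simp)
    exact ⟨p, hp⟩
  obtain ⟨p, hp⟩ := hlim x
  obtain ⟨r, hr, hiso⟩ := exists_isolating_radius (hfin p) p
  refine ⟨min r (c / 2), by positivity, fun y hy => ?_⟩
  obtain ⟨q, hq⟩ := hlim fun m : ℤ => (f ^ m) y
  have hdist : ∀ k : ℤ, dist ((f ^ k) q) ((f ^ k) p) ≤ min r (c / 2) := fun k => by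
    have h1 : Tendsto (fun m : ℤ => (f ^ k) ((f ^ m) y)) U (𝓝 ((f ^ k) q)) :=
      ((f ^ k).continuous.tendsto _).comp hq
    refine le_of_tendsto (h1.dist (tendsto_shift_zpow hU hx hp k)) ?_
    have h2 := (tendsto_atTop_add_const_right atTop k tendsto_id).eventually hy
    filter_upwards [hU h2] with m hm
    rw [← zpow_add_apply, add_comm k]
    exact hm.le
  -- The limit `q` lies in the dynamical ball of `p`, within its isolating radius. Hence `y` is
  -- proximal to `x`.
  have hqp : q = p := by
    refine hiso q (fun k => ?_) ?_
    · have := (hdist k).trans (min_le_right _ _)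
      linarith
    · simpa using (hdist 0).trans (min_le_left _ _)
  subst hqp
  refine tendsto_dist_of_frequently_small hs hc hfin hx
    (hy.mono fun k hk => hk.trans_le (min_le_right _ _)) fun η hη => ?_
  have h3 : Tendsto (fun m : ℤ => dist ((f ^ m) y) (x m)) U (𝓝 0) := by
    simpa using hq.dist hp
  exact (h3.eventually_lt_const hη).frequently.filter_mono hU

theorem exists_tail_shadowing_tendsto_atBot {f : X ≃ₜ X} (hs : HasShadowing f) {c : ℝ}
    (hc : 0 < c) (hfin : ∀ x, (dynamicalBall f c x).Finite) {x : ℤ → X}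
    (hx : Tendsto (fun k : ℤ => dist (f (x k)) (x (k + 1))) atBot (𝓝 0)) :
    ∃ ε : ℝ, 0 < ε ∧ ∀ y : X, (∀ᶠ k : ℤ in atBot, dist ((f ^ k) y) (x k) < ε) →
      Tendsto (fun k : ℤ => dist ((f ^ k) y) (x k)) atBot (𝓝 0) := by
  have hx' : Tendsto (fun k : ℤ => dist (f⁻¹ (x (-k))) (x (-(k + 1)))) atTop (𝓝 0) := by
    rw [Metric.tendsto_nhds]
    intro ε hε
    obtain ⟨δ, hδ, h⟩ := exists_dist_inv_lt f hε
    have h1 : Tendsto (fun k : ℤ => -(k + 1)) atTop atBot :=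
      tendsto_neg_atTop_atBot.comp (tendsto_atTop_add_const_right _ 1 tendsto_id)
    filter_upwards [h1.eventually (hx.eventually_lt_const hδ)] with k hk
    rw [Real.dist_0_eq_abs, abs_of_nonneg dist_nonneg]
    rw [show -(k + 1) + 1 = -k by ring] at hk
    exact h _ _ hk
  obtain ⟨ε, hε, h⟩ := exists_tail_shadowing_tendsto hs.inv hc
    (fun a => by rw [dynamicalBall_inv]; exact hfin a) (x := fun k => x (-k)) hx'
  refine ⟨ε, hε, fun y hy => ?_⟩
  have h2 := h y <| by
    simp only [inv_zpow_apply]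
    exact tendsto_neg_atTop_atBot.eventually hy
  simp only [inv_zpow_apply] at h2
  simpa only [Function.comp_def, neg_neg] using h2.comp tendsto_neg_atBot_atTop

end LimitShadowing

/-! ### Existence of a periodic point -/

section Periodic

variable {X : Type*} [MetricSpace X] [CompactSpace X]

theorem exists_dist_zpow_lt [Nonempty X] (f : X ≃ₜ X) {δ : ℝ} (hδ : 0 < δ) :
    ∃ (a : X) (L : ℤ), 0 < L ∧ dist ((f ^ L) a) a < δ := by
  obtain ⟨a⟩ := ‹Nonempty X›
  obtain ⟨p, -, φ, hφ, hp⟩ := isCompact_univ.tendsto_subseq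
    (x := fun k : ℕ => (f ^ (k : ℤ)) a) fun _ => Set.mem_univ _
  obtain ⟨N, hN⟩ := Metric.cauchySeq_iff.1 hp.cauchySeq δ hδ
  refine ⟨(f ^ (φ N : ℤ)) a, φ (N + 1) - φ N, ?_, ?_⟩
  · have := hφ (Nat.lt_succ_self N)
    simp only [Nat.succ_eq_add_one] at this
    omega
  · rw [← zpow_add_apply, sub_add_cancel]
    exact hN (N + 1) (Nat.le_succ N) N le_rfl

/-- Repeating an almost closed orbit segment of length `L` gives an `L`-periodic pseudo-orbit. All
`f ^ L`-iterates of a shadowing point shadow it too, so they share a finite dynamical ball and two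
coincide. -/
theorem exists_periodic_point [Nonempty X] {f : X ≃ₜ X} (hs : HasShadowing f) {c : ℝ} (hc : 0 < c)
    (hfin : ∀ x, (dynamicalBall f c x).Finite) : ∃ (z : X) (M : ℕ), 0 < M ∧ (f ^ (M : ℤ)) z = z := by
  obtain ⟨δ, hδ, hsh⟩ := hs (c / 2) (by positivity)
  obtain ⟨a, L, hL, haL⟩ := exists_dist_zpow_lt f hδ
  obtain ⟨y, hy⟩ := hsh (fun k => (f ^ (k % L)) a) fun k => by
    have h0 := Int.emod_nonneg k hL.ne'
    have h1 := Int.emod_lt_of_pos k hL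
    dsimp only
    rw [← zpow_add_one_apply]
    rcases (show k % L + 1 < L ∨ k % L + 1 = L by omega) with h | h
    · have e : (k + 1) % L = k % L + 1 := by
        rw [Int.add_emod, ← Int.emod_eq_of_lt (by omega) h]
        simp
      simp [e, hδ]
    · have e : (k + 1) % L = 0 := by
        rw [← Int.emod_add_emod, h, Int.emod_self]
      rw [e, h]
      simpa using haL
  dsimp only at hy
  have hmem : ∀ t : ℕ, (f ^ (L * t)) y ∈ dynamicalBall f c y := fun t k => by
    have h1 := hy (k + L * t)
    have h2 := hy k
    rw [zpow_add_apply, Int.add_mul_emod_self_left] at h1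
    have := dist_triangle_right ((f ^ k) ((f ^ (L * t)) y)) ((f ^ k) y) ((f ^ (k % L)) a)
    linarith
  obtain ⟨s, -, t, -, hne, hst⟩ := Set.infinite_univ.exists_ne_map_eq_of_mapsTo
    (fun t _ => hmem t) (hfin y)
  wlog hlt : s < t generalizing s t
  · exact this t s hne.symm hst.symm (by omega)
  have hst' : (s : ℤ) < t := by exact_mod_cast hlt
  refine ⟨(f ^ (L * s)) y, (L * (t - s)).toNat, ?_, ?_⟩
  · have : 0 < L * (t - s) := mul_pos hL (by omega)
    omega
  · have : 0 < L * (t - s) := mul_pos hL (by omega)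
    rw [Int.toNat_of_nonneg this.le, ← zpow_add_apply, hst]
    congr 2
    ring

end Periodic

/-! ### Chains and gluing of pseudo-orbits -/

section Chains

variable {X : Type*} [MetricSpace X]

/-- `IsChain f δ L a b`: there is a `δ`-chain with `L` steps from `a` to `b`. -/
inductive IsChain (f : X ≃ₜ X) (δ : ℝ) : ℕ → X → X → Prop
  | nil (a : X) : IsChain f δ 0 a a
  | snoc {L : ℕ} {a b c : X} : IsChain f δ L a b → dist (f b) c < δ → IsChain f δ (L + 1) a c

theorem IsChain.trans {f : X ≃ₜ X} {δ : ℝ} {K L : ℕ} {a b c : X} (h : IsChain f δ K a b)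
    (h' : IsChain f δ L b c) : IsChain f δ (K + L) a c := by
  induction h' with
  | nil => exact h
  | snoc _ hd ih => exact (ih h).snoc hd

theorem IsChain.orbit {f : X ≃ₜ X} {δ : ℝ} (hδ : 0 < δ) (a : X) (k : ℕ) :
    IsChain f δ k a ((f ^ (k : ℤ)) a) := by
  induction k with
  | zero => simpa using IsChain.nil a
  | succ k ih =>
    refine ih.snoc ?_
    rw [Nat.cast_succ, zpow_add_one_apply, dist_self]
    exact hδ

theorem IsChain.iterate {f : X ≃ₜ X} {δ : ℝ} {M : ℕ} {a : X} (h : IsChain f δ M a a) (j : ℕ) :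
    IsChain f δ (M * j) a a := by
  induction j with
  | zero => exact .nil a
  | succ j ih => exact ih.trans h

theorem IsTransitive.exists_isChain {f : X ≃ₜ X} (h : IsTransitive f) {δ : ℝ} (hδ : 0 < δ)
    (a b : X) : ∃ L, IsChain f δ L a b := by
  -- One jump leads from `a` into the first ball, one more from the second set to `b`; a true orbit
  -- runs between.
  obtain ⟨k, w, ⟨v, hv, rfl⟩, hw⟩ := h (Metric.ball (f a) δ) (f ⁻¹' Metric.ball b δ)
    Metric.isOpen_ball (Metric.isOpen_ball.preimage f.continuous)
    ⟨f a, Metric.mem_ball_self hδ⟩ ⟨f.symm b, by simpa using hδ⟩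
  have h1 : IsChain f δ 1 a v := (IsChain.nil a).snoc (by rw [dist_comm]; exact hv)
  exact ⟨_, (h1.trans (IsChain.orbit hδ v k)).snoc hw⟩

theorem IsChain.exists_fun {f : X ≃ₜ X} {δ : ℝ} {L : ℕ} {a b : X} (h : IsChain f δ L a b) (s : ℤ) :
    ∃ w : ℤ → X, w s = a ∧ w (s + L) = b ∧
      ∀ k, s ≤ k → k < s + L → dist (f (w k)) (w (k + 1)) < δ := by
  induction h with
  | nil a => exact ⟨fun _ => a, rfl, rfl, fun k h1 h2 => by simp at h2; omega⟩
  | @snoc L a b c _ hd ih =>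
    obtain ⟨w, hs, hL, hw⟩ := ih
    refine ⟨Function.update w (s + L + 1) c, ?_, ?_, fun k h1 h2 => ?_⟩
    · rw [Function.update_of_ne (by omega), hs]
    · rw [Nat.cast_succ, ← add_assoc, Function.update_self]
    · push_cast at h2
      rw [Function.update_of_ne (by omega)]
      rcases (show k < s + L ∨ k = s + L by omega) with h | rfl
      · rw [Function.update_of_ne (by omega)]
        exact hw k h1 h
      · rwa [Function.update_self, hL]

/-- Two half-infinite pseudo-orbits, one ending at time `s` near `q` and the other starting at
time `t` near `p`, can be joined by a chain from `q` to `p`; the forward part is delayed by `K`. -/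
theorem exists_isPseudoOrbit_of_isChain {f : X ≃ₜ X} {δ : ℝ} {x : ℤ → X} {s t K : ℤ} {p q : X}
    {L : ℕ} (hch : IsChain f (δ / 2) L q p) (hL0 : 0 < L) (hL : s + L = t + K)
    (hback : ∀ k < s, dist (f (x k)) (x (k + 1)) < δ / 2)
    (hforw : ∀ k, t ≤ k → dist (f (x k)) (x (k + 1)) < δ / 2)
    (hq : dist (x s) q < δ / 2) (hp : dist (x t) p < δ / 2) :
    ∃ w : ℤ → X, IsPseudoOrbit f δ w ∧ (∀ k < s, w k = x k) ∧ ∀ k, t ≤ k → w (K + k) = x k := by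
  obtain ⟨v, hvs, hvt, hv⟩ := hch.exists_fun s
  have hδ : 0 < δ := by linarith [dist_nonneg (x := x s) (y := q)]
  have hst : s < t + K := by omega
  rw [hL] at hvt hv
  refine ⟨fun k => if k < s then x k else if k < t + K then v k else x (k - K), fun k => ?_,
    fun k hk => if_pos hk, fun k hk => ?_⟩
  · dsimp only
    rcases lt_trichotomy (k + 1) s with h | h | h
    · rw [if_pos h, if_pos (by omega)]
      linarith [hback k (by omega)]
    · have h1 := hback k (by omega)
      rw [if_pos (show k < s by omega), h, if_neg (lt_irrefl s), if_pos hst, hvs]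
      rw [h] at h1
      linarith [dist_triangle (f (x k)) (x s) q]
    · rw [if_neg (show ¬ k + 1 < s by omega), if_neg (show ¬ k < s by omega)]
      rcases lt_trichotomy (k + 1) (t + K) with hk | hk | hk
      · rw [if_pos hk, if_pos (by omega)]
        linarith [hv k (by omega) (by omega)]
      · have h1 := hv k (by omega) (by omega)
        rw [if_pos (show k < t + K by omega), hk, if_neg (lt_irrefl _), add_sub_cancel_right]
        rw [hk, hvt] at h1
        linarith [dist_triangle_right (f (v k)) (x t) p]
      · rw [if_neg (by omega), if_neg (by omega)]
        have := hforw (k - K) (by omega)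
        rw [show k - K + 1 = k + 1 - K by ring] at this
        linarith
  · dsimp only
    rw [if_neg (by omega), if_neg (by omega), add_sub_cancel_left]

end Chains

end ShadowingGap

/-! ### The main theorem -/

open ShadowingGap Filter Topology

theorem theorem2p1 {X : Type*} [MetricSpace X] [CompactSpace X] (f : X ≃ₜ X) (n : ℕ)
    (hexp : ShadowingGap.IsNExpansive f n)
    (htrans : ShadowingGap.IsTransitive f)
    (hshad : ShadowingGap.HasShadowing f) :
    ShadowingGap.HasTwoSidedLimitShadowingWithAGap f := by
  obtain ⟨c, hc, hfin⟩ := hexp.exists_finite_dynamicalBall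
  rcases isEmpty_or_nonempty X with hX | hX
  · exact ⟨0, fun x => (hX.false (x 0)).elim⟩
  obtain ⟨z, M, hM, hz⟩ := exists_periodic_point hshad hc hfin
  refine ⟨M, fun x hx => ?_⟩
  obtain ⟨hxb, hxt⟩ := tendsto_sup.1 hx
  obtain ⟨ε₁, hε₁, hb⟩ := exists_tail_shadowing_tendsto_atBot hshad hc hfin hxb
  obtain ⟨ε₂, hε₂, ht⟩ := exists_tail_shadowing_tendsto hshad hc hfin hxt
  obtain ⟨δ, hδ, hsh⟩ := hshad (min ε₁ ε₂) (lt_min hε₁ hε₂)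
  have hδ2 : 0 < δ / 2 := by positivity
  obtain ⟨q, -, hq⟩ := isCompact_univ.exists_mapClusterPt_of_frequently (l := atBot) (f := x)
    (Frequently.of_forall fun _ => Set.mem_univ _)
  obtain ⟨p, -, hp⟩ := isCompact_univ.exists_mapClusterPt_of_frequently (l := atTop) (f := x)
    (Frequently.of_forall fun _ => Set.mem_univ _)
  obtain ⟨L₁, h₁⟩ := htrans.exists_isChain hδ2 q z
  obtain ⟨L₂, h₂⟩ := htrans.exists_isChain hδ2 z p
  have hloop : IsChain f (δ / 2) M z z := by
    simpa only [hz] using IsChain.orbit (f := f) hδ2 z M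
  obtain ⟨S, hS⟩ := eventually_atBot.1 (hxb.eventually_lt_const hδ2)
  obtain ⟨T, hT⟩ := eventually_atTop.1 (hxt.eventually_lt_const hδ2)
  obtain ⟨s, hqs, hs⟩ := ((hq.frequently (Metric.ball_mem_nhds q hδ2)).and_eventually
    (eventually_le_atBot S)).exists
  -- Taking `t` this late leaves room for both connecting chains; the `+ 1` keeps the joined chain
  -- nonempty.
  obtain ⟨t, hpt, htT⟩ := ((hp.frequently (Metric.ball_mem_nhds p hδ2)).and_eventually
    (eventually_ge_atTop (max T (s + (L₁ + L₂) + 1)))).exists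
  have hM' : (0 : ℤ) < M := by exact_mod_cast hM
  have htT' : T ≤ t := (le_max_left _ _).trans htT
  have hts : s + (L₁ + L₂) + 1 ≤ t := (le_max_right _ _).trans htT
  -- The delay `K` is a residue mod `M`, chosen so that the time left at `z` is exactly `j` loops.
  obtain ⟨K, hK0, hKM, j, hj⟩ : ∃ K : ℤ, 0 ≤ K ∧ K < M ∧ ∃ j : ℕ,
      t + K - s - (L₁ + L₂) = M * j := by
    refine ⟨(s + (L₁ + L₂) - t) % M, Int.emod_nonneg _ hM'.ne', Int.emod_lt_of_pos _ hM',
      (-((s + (L₁ + L₂) - t) / M)).toNat, ?_⟩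
    have h := Int.emod_add_mul_ediv (s + (L₁ + L₂) - t) M
    have hneg : (s + (L₁ + L₂) - t) / M < 0 := Int.ediv_neg_of_neg_of_pos (by omega) hM'
    rw [Int.toNat_of_nonneg (by omega)]
    linarith
  obtain ⟨w, hw, hws, hwt⟩ := exists_isPseudoOrbit_of_isChain (x := x) (s := s) (t := t) (K := K)
    ((h₁.trans (hloop.iterate j)).trans h₂)
    (by zify; linarith) (by push_cast; linarith) (fun k hk => hS k (by omega))
    (fun k hk => hT k (by omega)) hqs hpt
  obtain ⟨y, hy⟩ := hsh w hw
  refine ⟨K, by rw [abs_of_nonneg hK0]; exact hKM.le, y, hb y ?_, ?_⟩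
  · filter_upwards [eventually_lt_atBot s] with k hk
    rw [← hws k hk]
    exact (hy k).trans_le (min_le_left _ _)
  -- The forward tail is followed by `(f ^ K) y`.
  · have hcomm : ∀ k, (f ^ (K + k)) y = (f ^ k) ((f ^ K) y) := fun k => by
      rw [add_comm, zpow_add_apply]
    simp only [hcomm]
    refine ht _ ?_
    filter_upwards [eventually_ge_atTop t] with k hk
    rw [← hwt k hk, ← hcomm]
    exact (hy (K + k)).trans_le (min_le_right _ _)
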